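/- **Conventions.** A compact line is a nonempty linearly ordered set $K$ whose order topology is compact; $0_K$ and $1_K$ denote its least and greatest elements. A gauge on $K$ is a map $\delta$ assigning to each $x\in K$ an interval $\delta(x)\subseteq K$ that is open in $K$ and contains $x$. A tagged partition $P$ of $K$ consists of points $0_K=x_0\le x_1\le\dots\le x_n=1_K$ and tags $t_i\in[x_{i-1},x_i]$ for $1\le i\le n$; it is $\delta$-fine if $(x_{i-1},x_i]\subseteq\delta(t_i)$ for all $i$. For $f,G:K\to\mathbb R$ put $$S(f,G,P)=f(0_K)G(0_K)+\sum_{i=1}^n f(t_i)\bigl(G(x_i)-G(x_{i-1})\bigr).$$ The function $f$ is $G$-integrable, with integral $\int_K f\,dG=A\in\mathbb R$, if for every $\varepsilon>0$ there is a gauge $\delta$ on $K$ such that $|S(f,G,P)-A|<\varepsilon$ for every $\delta$-fine tagged partition $P$ of $K$. The function $G$ is amenable if it is right-continuous on $K$ and has a finite left-hand limit at every point $x$ that is a limit of points less than $x$, and a finite right-hand limit at every point $x$ that is a limit of points greater than $x$. **Theorem (Dominated Convergence).** Let $K$ be a compact line and let $G:K\to\mathbb R$ be nondecreasing, positive (that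 is, $G(x)\ge 0$ for all $x\in K$) and amenable. Let $(f_m)_{m\in\mathbb N}$ be a sequence of $G$-integrable functions $f_m:K\to\mathbb R$, and let $g,h:K\to\mathbb R$ be $G$-integrable functions such that $g(x)\le f_m(x)\le h(x)$ for all $m\in\mathbb N$ and $x\in K$. If $(f_m)_m$ converges pointwise on $K$ to a function $f:K\to\mathbb R$, then $f$ is $G$-integrable and $$\lim_{m\to\infty}\int_K f_m\,dG=\int_K f\,dG.$$ -/

import Mathlib

open Set Filter Topology

namespace CompactLine

section Order

variable {K : Type*} [LinearOrder K]

/-- A tagged partition `{([x_i, x_{i+1}], t_i) : i < n}` of `K`, with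
`0_K = x_0 ≤ x_1 ≤ ⋯ ≤ x_n = 1_K` and `t_i ∈ [x_i, x_{i+1}]`.
The points are given by sequences, of which only `x 0, …, x n` and `t 0, …, t (n - 1)` matter. -/
structure TaggedPartition (K : Type*) [LinearOrder K] where
  n : ℕ
  x : ℕ → K
  t : ℕ → K
  /-- The first division point is the least element `0_K` of `K`. -/
  isBot_first : IsBot (x 0)
  /-- The last division point is the greatest element `1_K` of `K`. -/
  isTop_last : IsTop (x n)
  le_succ : ∀ i < n, x i ≤ x (i + 1)
  tag_mem : ∀ i < n, t i ∈ Icc (x i) (x (i + 1))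

/-- `P` is `δ`-fine: `(x_i, x_{i+1}] ⊆ δ(t_i)` for every component of `P`. -/
def TaggedPartition.IsFine (P : TaggedPartition K) (δ : K → Set K) : Prop :=
  ∀ i < P.n, Ioc (P.x i) (P.x (i + 1)) ⊆ δ (P.t i)

/-- The Riemann sum
`S(f, G, P) = f(0_K) G(0_K) + ∑_i f(t_i) (G(x_{i+1}) - G(x_i))`; recall that `P.x 0 = 0_K`. -/
def riemannSum (f G : K → ℝ) (P : TaggedPartition K) : ℝ :=
  f (P.x 0) * G (P.x 0) +
    ∑ i ∈ Finset.range P.n, f (P.t i) * (G (P.x (i + 1)) - G (P.x i))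

end Order

section Topology

variable {K : Type*} [LinearOrder K] [TopologicalSpace K]

/-- A gauge on `K` assigns to each point `x` an open interval (an interval that is an open subset
of `K`) containing `x`. -/
def IsGauge (δ : K → Set K) : Prop :=
  ∀ x, IsOpen (δ x) ∧ (δ x).OrdConnected ∧ x ∈ δ x

/-- `A` is a Kurzweil–Stieltjes integral of `f` with respect to `G` over `K`. -/
def HasIntegral (f G : K → ℝ) (A : ℝ) : Prop :=
  ∀ ε > 0, ∃ δ : K → Set K, IsGauge δ ∧
    ∀ P : TaggedPartition K, P.IsFine δ → |riemannSum f G P - A| < ε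

/-- `f` is Kurzweil–Stieltjes integrable with respect to `G` (`G`-integrable). -/
def Integrable (f G : K → ℝ) : Prop :=
  ∃ A, HasIntegral f G A

open scoped Classical in
/-- The Kurzweil–Stieltjes integral `∫_K f dG` (with value `0` if `f` is not `G`-integrable). -/
noncomputable def integral (f G : K → ℝ) : ℝ :=
  if hf : Integrable f G then hf.choose else 0

/-- `x` is left-dense: every neighborhood of `x` contains a point less than `x`. -/
def IsLeftDense (x : K) : Prop := ∀ U ∈ 𝓝 x, ∃ y ∈ U, y < x

/-- `x` is right-dense: every neighborhood of `x` contains a point greater than `x`. -/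
def IsRightDense (x : K) : Prop := ∀ U ∈ 𝓝 x, ∃ y ∈ U, x < y

/-- `G` is regulated: it has a (finite) left-hand limit at every left-dense point and a (finite)
right-hand limit at every right-dense point. -/
def IsRegulated (G : K → ℝ) : Prop :=
  ∀ x, (IsLeftDense x → ∃ A : ℝ, Tendsto G (𝓝[<] x) (𝓝 A)) ∧
    (IsRightDense x → ∃ A : ℝ, Tendsto G (𝓝[>] x) (𝓝 A))

/-- `G` is amenable: right-continuous and regulated.  (Right-continuity at the greatest element
holds automatically.) -/
def IsAmenable (G : K → ℝ) : Prop :=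
  (∀ x, ContinuousWithinAt G (Ici x) x) ∧ IsRegulated G

end Topology

end CompactLine

/-!
The proof stays inside the gauge theory; no measure is constructed. The initial term `f(0_K) G(0_K)`
depends continuously on `f(0_K)` and is split off. What is left is a limit of Riemann sums along a
filter on finite chains of tagged intervals (`fineFilter`), and this filter is proper because every
gauge admits a fine chain between any two points `a ≤ b` (Cousin's lemma, `exists_fineChain`).
Linearity, monotonicity and uniqueness of the integral are then facts about limits along a filter.

* *Monotone convergence* (`tendsto_chainSum_of_monotone`). The lower estimate is immediate. For the
  upper one, write `f = u₀ + ∑ (uₖ₊₁ - uₖ)`, and let the gauge at `t` respect only the gauges of the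
  finitely many increments that are needed to approximate `f t`. The intervals of a fine chain that
  respect the gauge of the `k`-th increment can be completed by Cousin's lemma to a full chain which
  is fine for that gauge; as the increment is nonnegative, their share of its Riemann sum is at most
  its integral plus a small error.
* *Absolute integrability* (`exists_tendsto_chainSum_abs`). Suppose that `φ` is integrable and
  `|φ| ≤ w` with `w` integrable. Fix a chain `l₀` that is fine for a Cauchy gauge of `φ`. A
  sufficiently fine chain can be cut at the division points of `l₀`. Within each interval of `l₀`
  one may use either the interval itself or the piece of the finer chain, and all the chains
  obtained in this way are fine, so their sums differ by at most `ε`. Hence the sum of `|φ|` over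
  `l₀` exceeds the sum over the finer chain by at most `ε`: the sums of `|φ|` are almost increasing,
  and they are bounded by those of `w`. Thus they converge.

Consequently minima of finitely many `F m` are integrable. Monotone convergence, used once downwards
and once upwards, shows that the functions `⨅ k ≥ n, F k` are integrable, that `f` is, and that the
integrals of the former converge to that of `f`. The same for `-F` and a squeeze finish the proof.
-/

namespace CompactLine

/-! ### Chains of tagged intervals and their Riemann sums -/

section Chains

variable {K : Type*}

/-- The Riemann sum of `f` with respect to `G` over a list of tagged intervals `(x, t, y)`, without
the initial term of `riemannSum`. -/
def chainSum (G f : K → ℝ) (l : List (K × K × K)) : ℝ :=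
  (l.map fun p => f p.2.1 * (G p.2.2 - G p.1)).sum

variable {G f g : K → ℝ} {l p q : List (K × K × K)}

@[simp] lemma chainSum_nil : chainSum G f [] = 0 := rfl

@[simp] lemma chainSum_cons (x t y : K) :
    chainSum G f ((x, t, y) :: l) = f t * (G y - G x) + chainSum G f l := by
  simp [chainSum]

@[simp] lemma chainSum_append : chainSum G f (p ++ q) = chainSum G f p + chainSum G f q := by
  simp [chainSum]

lemma chainSum_add : chainSum G (fun t => f t + g t) l = chainSum G f l + chainSum G g l := by
  induction l with
  | nil => simp
  | cons p l ih => obtain ⟨x, t, y⟩ := p; simp only [chainSum_cons, ih]; ring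

lemma chainSum_const_mul (r : ℝ) : chainSum G (fun t => r * f t) l = r * chainSum G f l := by
  induction l with
  | nil => simp
  | cons p l ih => obtain ⟨x, t, y⟩ := p; simp only [chainSum_cons, ih]; ring

lemma chainSum_sum (s : Finset ℕ) (v : ℕ → K → ℝ) :
    chainSum G (fun t => ∑ k ∈ s, v k t) l = ∑ k ∈ s, chainSum G (v k) l := by
  induction l with
  | nil => simp
  | cons p l ih =>
    obtain ⟨x, t, y⟩ := p
    simp only [chainSum_cons, ih, Finset.sum_add_distrib, Finset.sum_mul]

variable [LinearOrder K]

/-- `FineChain δ a b l`: the list `l` of triples `(x, t, y)`, each standing for the interval `(x, y]`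
with tag `t ∈ [x, y]`, leads from `a` to `b` by consecutive intervals and is `δ`-fine. -/
inductive FineChain (δ : K → Set K) : K → K → List (K × K × K) → Prop
  | nil (a : K) : FineChain δ a a []
  | cons {a t y b : K} {l : List (K × K × K)} (hat : a ≤ t) (hty : t ≤ y)
      (hδ : Ioc a y ⊆ δ t) (hl : FineChain δ y b l) : FineChain δ a b ((a, t, y) :: l)

variable {δ δ' : K → Set K} {a b c : K}

lemma FineChain.le (h : FineChain δ a b l) : a ≤ b := by
  induction h with
  | nil => exact le_rfl
  | cons hat hty _ _ ih => exact (hat.trans hty).trans ih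

lemma FineChain.append (hp : FineChain δ a b p) (hq : FineChain δ b c q) :
    FineChain δ a c (p ++ q) := by
  induction hp with
  | nil => exact hq
  | cons hat hty hδ _ ih => exact .cons hat hty hδ (ih hq)

lemma FineChain.mono (h : FineChain δ a b l) (hδ : ∀ t, a ≤ t → δ t ⊆ δ' t) :
    FineChain δ' a b l := by
  induction h with
  | nil => exact .nil _
  | cons hat hty hsub _ ih =>
    exact .cons hat hty (hsub.trans (hδ _ hat))
      (ih fun t ht => hδ t ((hat.trans hty).trans ht))

lemma FineChain.chainSum_const (h : FineChain δ a b l) (r : ℝ) :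
    chainSum G (fun _ => r) l = r * (G b - G a) := by
  induction h with
  | nil => simp
  | cons _ _ _ _ ih => rw [chainSum_cons, ih]; ring

lemma FineChain.chainSum_le_of_mem (hG : Monotone G) (h : FineChain δ a b l)
    (hfg : ∀ p ∈ l, f p.2.1 ≤ g p.2.1) : chainSum G f l ≤ chainSum G g l := by
  induction h with
  | nil => simp
  | @cons x t y b l hat hty _ _ ih =>
    rw [chainSum_cons, chainSum_cons]
    have h1 : f t ≤ g t := hfg (x, t, y) (by simp)
    have h2 : 0 ≤ G y - G x := sub_nonneg.2 (hG (hat.trans hty))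
    have h3 := ih fun p hp => hfg p (by simp [hp])
    gcongr

lemma FineChain.chainSum_le (hG : Monotone G) (h : FineChain δ a b l) (hfg : ∀ t, f t ≤ g t) :
    chainSum G f l ≤ chainSum G g l :=
  h.chainSum_le_of_mem hG fun p _ => hfg p.2.1

lemma FineChain.chainSum_nonneg (hG : Monotone G) (h : FineChain δ a b l) (hf : ∀ t, 0 ≤ f t) :
    0 ≤ chainSum G f l := by
  simpa [h.chainSum_const] using h.chainSum_le hG hf

lemma FineChain.abs_chainSum_le (hG : Monotone G) (h : FineChain δ a b l) :
    |chainSum G f l| ≤ chainSum G (fun t => |f t|) l := by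
  refine abs_le.2 ⟨?_, h.chainSum_le hG fun t => le_abs_self _⟩
  have := h.chainSum_le (f := fun t => -1 * |f t|) (g := f) hG fun t => by
    linarith [neg_abs_le (f t)]
  rw [chainSum_const_mul] at this
  linarith

end Chains

/-! ### Cousin's lemma -/

section Gauges

variable {K : Type*} [LinearOrder K] [TopologicalSpace K]

lemma isGauge_univ : IsGauge (fun _ : K => univ) :=
  fun x => ⟨isOpen_univ, ordConnected_univ, mem_univ x⟩

lemma IsGauge.inter {δ δ' : K → Set K} (h : IsGauge δ) (h' : IsGauge δ') :
    IsGauge fun t => δ t ∩ δ' t :=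
  fun x => ⟨(h x).1.inter (h' x).1, (h x).2.1.inter (h' x).2.1, (h x).2.2, (h' x).2.2⟩

variable [OrderTopology K] [CompactSpace K]

/-- **Cousin's lemma**: every gauge admits a fine chain from `a` to any `b ≥ a`. The points of
`[a, b]` that a fine chain can reach have a greatest limit point `c`. It is itself reachable, and
if `c < b` then one can step either to a point of `δ c` beyond `c` or to the successor of `c`. -/
lemma exists_fineChain {δ : K → Set K} (hδ : IsGauge δ) {a b : K} (hab : a ≤ b) :
    ∃ l, FineChain δ a b l := by
  set S : Set K := {x | x ≤ b ∧ ∃ l, FineChain δ a x l}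
  have haS : a ∈ S := ⟨hab, [], .nil a⟩
  obtain ⟨c, hc, hcmax⟩ :=
    (isClosed_closure (s := S)).isCompact.exists_isGreatest ⟨a, subset_closure haS⟩
  have hle : ∀ x ∈ S, x ≤ c := fun x hx => hcmax (subset_closure hx)
  have hSb : closure S ⊆ Iic b := closure_minimal (fun x hx => hx.1) isClosed_Iic
  have step : ∀ {x t y : K}, x ∈ S → x ≤ t → t ≤ y → y ≤ b → Ioc x y ⊆ δ t → y ∈ S := by
    rintro x t y ⟨-, l, hl⟩ hxt hty hyb hsub
    exact ⟨hyb, _, hl.append (.cons hxt hty hsub (.nil y))⟩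
  have hcS : c ∈ S := by
    obtain ⟨y, hyδ, hyS⟩ := mem_closure_iff.1 hc (δ c) (hδ c).1 (hδ c).2.2
    refine step hyS (hle y hyS) le_rfl (hSb hc) ?_
    exact Ioc_subset_Icc_self.trans ((hδ c).2.1.out hyδ (hδ c).2.2)
  obtain hcb | hcb := (hSb hc : c ≤ b).lt_or_eq
  · exfalso
    have hno : ∀ z, c < z → z ≤ b → z ∉ δ c := fun z hcz hzb hz =>
      hcz.not_ge <| hle z <| step hcS le_rfl hcz.le hzb <|
        Ioc_subset_Icc_self.trans ((hδ c).2.1.out (hδ c).2.2 hz)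
    have hsub : δ c ⊆ Iic c := fun z hz => by
      by_contra hcz
      have hcz : c < z := not_le.1 hcz
      rcases le_total z b with hzb | hbz
      · exact hno z hcz hzb hz
      · exact hno b hcb le_rfl ((hδ c).2.1.out (hδ c).2.2 hz ⟨hcb.le, hbz⟩)
    have hopen : IsOpen (Iic c) := by
      have : Iic c = Iio c ∪ δ c := by
        ext z
        refine ⟨fun hz => ?_, ?_⟩
        · rcases (hz : z ≤ c).lt_or_eq with h | h
          · exact Or.inl h
          · exact Or.inr (h ▸ (hδ c).2.2)
        · rintro (h | h)
          · exact le_of_lt h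
          · exact hsub h
      rw [this]
      exact isOpen_Iio.union (hδ c).1
    have hclosed : IsClosed (Ioi c) := by
      rw [← compl_Iic]
      exact hopen.isClosed_compl
    obtain ⟨z, hcz, hz⟩ := hclosed.isCompact.exists_isLeast ⟨b, hcb⟩
    refine (hcz : c < z).not_ge (hle z (step hcS (le_of_lt hcz) le_rfl (hz hcb) ?_))
    intro y hy
    rw [le_antisymm hy.2 (hz hy.1)]
    exact (hδ z).2.2
  · exact hcb ▸ hcS.2

/-- If the gauge of `l` refines `δ` at the tags in `T`, then the intervals of `l` with tag in `T` are
part of a `δ`-fine chain with the same ends. -/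
lemma FineChain.exists_chainSum_indicator_le {G v : K → ℝ} (hG : Monotone G) (hv : ∀ t, 0 ≤ v t)
    {δ δ' : K → Set K} (hδ : IsGauge δ) {T : Set K} (hT : ∀ t ∈ T, δ' t ⊆ δ t) {a b : K}
    {l : List (K × K × K)} (hl : FineChain δ' a b l) :
    ∃ p, FineChain δ a b p ∧ chainSum G (T.indicator v) l ≤ chainSum G v p := by
  induction hl with
  | nil => exact ⟨[], .nil _, by simp⟩
  | @cons x t y b l hat hty hsub _ ih =>
    obtain ⟨p, hp, hle⟩ := ih
    by_cases ht : t ∈ T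
    · refine ⟨(x, t, y) :: p, .cons hat hty (hsub.trans (hT t ht)) hp, ?_⟩
      simpa [ht] using hle
    · obtain ⟨r, hr⟩ := exists_fineChain hδ (hat.trans hty)
      refine ⟨r ++ p, hr.append hp, ?_⟩
      have := hr.chainSum_nonneg hG hv
      simp only [chainSum_cons, indicator_of_notMem ht, zero_mul, zero_add, chainSum_append]
      linarith

end Gauges

/-! ### The filter of fine chains -/

section FineFilter

variable {K : Type*} [LinearOrder K] [TopologicalSpace K]

/-- The filter on lists of tagged intervals in which a set is large if it contains all chains from
`a` to `b` that are fine for some gauge. -/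
def fineFilter (a b : K) : Filter (List (K × K × K)) where
  sets := {s | ∃ δ, IsGauge δ ∧ ∀ l, FineChain δ a b l → l ∈ s}
  univ_sets := ⟨_, isGauge_univ, fun _ _ => mem_univ _⟩
  sets_of_superset := fun ⟨δ, hδ, h⟩ hst => ⟨δ, hδ, fun l hl => hst (h l hl)⟩
  inter_sets := fun ⟨_, hδ, h⟩ ⟨_, hδ', h'⟩ =>
    ⟨_, hδ.inter hδ', fun l hl => ⟨h l (hl.mono fun _ _ => inter_subset_left),
      h' l (hl.mono fun _ _ => inter_subset_right)⟩⟩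

lemma mem_fineFilter {a b : K} {s : Set (List (K × K × K))} :
    s ∈ fineFilter a b ↔ ∃ δ, IsGauge δ ∧ ∀ l, FineChain δ a b l → l ∈ s := Iff.rfl

lemma IsGauge.eventually_fineChain {δ : K → Set K} (hδ : IsGauge δ) (a b : K) :
    ∀ᶠ l in fineFilter a b, FineChain δ a b l :=
  ⟨δ, hδ, fun _ hl => hl⟩

lemma eventually_chainSum_le {G f g : K → ℝ} (hG : Monotone G) (hfg : ∀ t, f t ≤ g t) (a b : K) :
    ∀ᶠ l in fineFilter a b, chainSum G f l ≤ chainSum G g l :=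
  (isGauge_univ.eventually_fineChain a b).mono fun _ hl => hl.chainSum_le hG hfg

lemma fineFilter_neBot [OrderTopology K] [CompactSpace K] {a b : K} (hab : a ≤ b) :
    (fineFilter a b).NeBot := by
  refine Filter.neBot_iff.2 fun h => ?_
  obtain ⟨δ, hδ, hl⟩ := mem_fineFilter.1 (Filter.empty_mem_iff_bot.2 h)
  obtain ⟨l, hl'⟩ := exists_fineChain hδ hab
  exact hl l hl'

/-- Sufficiently fine chains from `a` to `d` can be cut at an intermediate point `b` into fine chains
from `a` to `b` and from `b` to `d`. The gauge forces `b` to be the tag of every interval with `b` in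
its interior. -/
lemma eventually_exists_split [OrderClosedTopology K] {G : K → ℝ} {a b d : K}
    (hab : a ≤ b) (hbd : b ≤ d)
    {s t : Set (List (K × K × K))} (hs : s ∈ fineFilter a b) (ht : t ∈ fineFilter b d) :
    ∀ᶠ l in fineFilter a d, ∃ p ∈ s, ∃ q ∈ t,
      ∀ f : K → ℝ, chainSum G f l = chainSum G f p + chainSum G f q := by
  obtain ⟨δ₁, hδ₁, hs⟩ := hs
  obtain ⟨δ₂, hδ₂, ht⟩ := ht
  set δ : K → Set K := fun t =>
    if t < b then δ₁ t ∩ Iio b else if b < t then δ₂ t ∩ Ioi b else δ₁ t ∩ δ₂ t with hδ_def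
  have hδ : IsGauge δ := by
    intro x
    simp only [hδ_def]
    split_ifs with h1 h2
    · exact ⟨(hδ₁ x).1.inter isOpen_Iio, (hδ₁ x).2.1.inter ordConnected_Iio, (hδ₁ x).2.2, h1⟩
    · exact ⟨(hδ₂ x).1.inter isOpen_Ioi, (hδ₂ x).2.1.inter ordConnected_Ioi, (hδ₂ x).2.2, h2⟩
    · exact hδ₁.inter hδ₂ x
  have hsub₁ : ∀ t ≤ b, δ t ⊆ δ₁ t := by
    intro t htb
    simp only [hδ_def, if_neg htb.not_gt]
    split_ifs <;> exact inter_subset_left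
  have hsub₂ : ∀ t, b ≤ t → δ t ⊆ δ₂ t := by
    intro t htb
    simp only [hδ_def, if_neg htb.not_gt]
    split_ifs
    · exact inter_subset_left
    · exact inter_subset_right
  have hlt : ∀ t < b, δ t ⊆ Iio b := by
    intro t htb
    simp only [hδ_def, if_pos htb]
    exact inter_subset_right
  have hgt : ∀ t, b < t → δ t ⊆ Ioi b := by
    intro t htb
    simp only [hδ_def, if_neg htb.not_gt, if_pos htb]
    exact inter_subset_right
  refine ⟨δ, hδ, fun l hl => ?_⟩
  suffices H : ∃ p, FineChain δ₁ a b p ∧ ∃ q, FineChain δ₂ b d q ∧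
      ∀ f : K → ℝ, chainSum G f l = chainSum G f p + chainSum G f q by
    obtain ⟨p, hp, q, hq, h⟩ := H
    exact ⟨p, hs p hp, q, ht q hq, h⟩
  clear hs ht
  induction hl with
  | nil x =>
    obtain rfl := le_antisymm hab hbd
    exact ⟨[], .nil _, [], .nil _, by simp⟩
  | @cons x t y d l hxt hty hsub hl ih =>
    obtain hxb | rfl := hab.lt_or_eq
    · rcases le_or_gt y b with hyb | hby
      · obtain ⟨p, hp, q, hq, h⟩ := ih hyb hbd
        refine ⟨(x, t, y) :: p, .cons hxt hty (hsub.trans (hsub₁ t (hty.trans hyb))) hp, q, hq,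
          fun f => ?_⟩
        simp only [chainSum_cons, h]
        ring
      · have htb : t = b := by
          refine le_antisymm (not_lt.1 fun h => ?_) (not_lt.1 fun h => ?_)
          · exact lt_irrefl b (hgt t h (hsub ⟨hxb, hby.le⟩))
          · exact hby.not_gt (hlt t h (hsub ⟨hxb.trans hby, le_rfl⟩))
        subst htb
        refine ⟨[(x, t, t)], .cons hxt le_rfl
          (((Ioc_subset_Ioc_right hty).trans hsub).trans (hsub₁ t le_rfl)) (.nil t),
          (t, t, y) :: l, .cons le_rfl hty
          (((Ioc_subset_Ioc_left hxt).trans hsub).trans (hsub₂ t le_rfl))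
          (hl.mono fun r hr => hsub₂ r (hty.trans hr)), fun f => ?_⟩
        simp only [chainSum_cons, chainSum_nil]
        ring
    · exact ⟨[], .nil _, (x, t, y) :: l, (FineChain.cons hxt hty hsub hl).mono hsub₂, by simp⟩

variable {G f g : K → ℝ} {a b : K} {A B : ℝ}

lemma tendsto_chainSum_add
    (hf : Tendsto (chainSum G f) (fineFilter a b) (𝓝 A))
    (hg : Tendsto (chainSum G g) (fineFilter a b) (𝓝 B)) :
    Tendsto (chainSum G fun t => f t + g t) (fineFilter a b) (𝓝 (A + B)) :=
  (hf.add hg).congr fun _ => chainSum_add.symm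

lemma tendsto_chainSum_const_mul (r : ℝ)
    (hf : Tendsto (chainSum G f) (fineFilter a b) (𝓝 A)) :
    Tendsto (chainSum G fun t => r * f t) (fineFilter a b) (𝓝 (r * A)) :=
  (hf.const_mul r).congr fun _ => (chainSum_const_mul r).symm

lemma tendsto_chainSum_neg
    (hf : Tendsto (chainSum G f) (fineFilter a b) (𝓝 A)) :
    Tendsto (chainSum G fun t => -f t) (fineFilter a b) (𝓝 (-A)) := by
  simpa using tendsto_chainSum_const_mul (-1) hf

lemma tendsto_chainSum_sub
    (hf : Tendsto (chainSum G f) (fineFilter a b) (𝓝 A))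
    (hg : Tendsto (chainSum G g) (fineFilter a b) (𝓝 B)) :
    Tendsto (chainSum G fun t => f t - g t) (fineFilter a b) (𝓝 (A - B)) := by
  simpa only [sub_eq_add_neg] using tendsto_chainSum_add hf (tendsto_chainSum_neg hg)

end FineFilter

/-! ### Monotone convergence -/

section Convergence

variable {K : Type*} [LinearOrder K] [TopologicalSpace K] [OrderTopology K] [CompactSpace K]
  {G : K → ℝ} {a b : K}

lemma le_of_tendsto_chainSum (hG : Monotone G) (hab : a ≤ b) {f g : K → ℝ} {A B : ℝ}
    (hf : Tendsto (chainSum G f) (fineFilter a b) (𝓝 A))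
    (hg : Tendsto (chainSum G g) (fineFilter a b) (𝓝 B)) (hfg : ∀ t, f t ≤ g t) : A ≤ B :=
  have := fineFilter_neBot hab
  le_of_tendsto_of_tendsto hf hg (eventually_chainSum_le hG hfg a b)

/-- The upper estimate in monotone convergence, by countable subadditivity: at the tag `t` the gauge
respects only the gauges of the increments `u (k + 1) - u k` with `k < N t`, where `u (N t) t` is
close to `f t`. -/
lemma eventually_chainSum_le_of_monotone (hG : Monotone G) (hab : a ≤ b) {u : ℕ → K → ℝ}
    {f : K → ℝ} {A : ℕ → ℝ} {B : ℝ}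
    (hu : ∀ n, Tendsto (chainSum G (u n)) (fineFilter a b) (𝓝 (A n)))
    (hmono : ∀ x, Monotone fun n => u n x)
    (hlim : ∀ x, Tendsto (fun n => u n x) atTop (𝓝 (f x))) (hB : ∀ n, A n ≤ B) {ε : ℝ}
    (hε : 0 < ε) : ∀ᶠ l in fineFilter a b, chainSum G f l ≤ B + 4 * ε := by
  have hm : 0 ≤ G b - G a := sub_nonneg.2 (hG hab)
  set η : ℝ := ε / (1 + (G b - G a)) with hη_def
  have hη : 0 < η := by positivity
  have hηm : η * (G b - G a) ≤ ε := by
    rw [hη_def, div_mul_eq_mul_div, div_le_iff₀ (by positivity)]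
    nlinarith
  have hinc : ∀ k, ∃ δ, IsGauge δ ∧ ∀ l, FineChain δ a b l →
      chainSum G (fun t => u (k + 1) t - u k t) l ≤ A (k + 1) - A k + ε * (1 / 2) ^ k := fun k =>
    mem_fineFilter.1 ((tendsto_chainSum_sub (hu (k + 1)) (hu k)).eventually_le_const
      (lt_add_of_pos_right _ (by positivity)))
  choose δ hδ hδle using hinc
  obtain ⟨δ₀, hδ₀, hδ₀le⟩ : ∃ δ, IsGauge δ ∧ ∀ l, FineChain δ a b l →
      chainSum G (u 0) l ≤ A 0 + ε :=
    mem_fineFilter.1 ((hu 0).eventually_le_const (lt_add_of_pos_right _ hε))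
  have hN : ∀ t, ∃ n, f t - η ≤ u n t := fun t =>
    ((hlim t).eventually_const_le (sub_lt_self _ hη)).exists
  choose N hN using hN
  have hγ : IsGauge fun t => δ₀ t ∩ ⋂ k ∈ Finset.range (N t), δ k t := by
    refine hδ₀.inter fun x => ⟨isOpen_biInter_finset fun k _ => (hδ k x).1,
      ordConnected_biInter fun k _ => (hδ k x).2.1, mem_iInter₂.2 fun k _ => (hδ k x).2.2⟩
  filter_upwards [hγ.eventually_fineChain a b] with l hl
  obtain ⟨M, hM⟩ : ∃ M, ∀ p ∈ l, N p.2.1 ≤ M :=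
    ⟨(l.map fun p => N p.2.1).sum, fun p hp => List.single_le_sum (by simp) _
      (List.mem_map_of_mem (f := fun p : K × K × K => N p.2.1) hp)⟩
  have hv : ∀ k t, 0 ≤ u (k + 1) t - u k t := fun k t => sub_nonneg.2 (hmono t k.le_succ)
  have hshare : ∀ k, chainSum G ({t | k < N t}.indicator fun t => u (k + 1) t - u k t) l ≤
      A (k + 1) - A k + ε * (1 / 2) ^ k := by
    intro k
    obtain ⟨p, hp, hle⟩ := hl.exists_chainSum_indicator_le hG (hv k) (hδ k) (T := {t | k < N t})
      fun t ht => inter_subset_right.trans (iInter₂_subset k (Finset.mem_range.2 ht))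
    exact hle.trans (hδle k p hp)
  have hpt : ∀ p ∈ l, f p.2.1 ≤ (u 0 p.2.1 + ∑ k ∈ Finset.range M,
      {t | k < N t}.indicator (fun t => u (k + 1) t - u k t) p.2.1) + η := by
    intro p hp
    have hsum : ∑ k ∈ Finset.range M,
        {t | k < N t}.indicator (fun t => u (k + 1) t - u k t) p.2.1 =
        u (N p.2.1) p.2.1 - u 0 p.2.1 := by
      rw [← Finset.sum_range_sub (fun k => u k p.2.1)]
      symm
      refine Finset.sum_subset_zero_on_sdiff (Finset.range_mono (hM p hp)) ?_ ?_
      · intro k hk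
        simp only [Finset.mem_sdiff, Finset.mem_range] at hk
        exact indicator_of_notMem (by simpa using hk.2) _
      · intro k hk
        exact (indicator_of_mem (s := {t | k < N t}) (Finset.mem_range.1 hk)
          fun t => u (k + 1) t - u k t).symm
    rw [hsum]
    linarith [hN p.2.1]
  calc chainSum G f l
      ≤ chainSum G (u 0) l + ∑ k ∈ Finset.range M,
          chainSum G ({t | k < N t}.indicator fun t => u (k + 1) t - u k t) l
          + η * (G b - G a) := by
        rw [← chainSum_sum, ← hl.chainSum_const η, ← chainSum_add, ← chainSum_add]
        exact hl.chainSum_le_of_mem hG hpt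
    _ ≤ (A 0 + ε) + ∑ k ∈ Finset.range M, (A (k + 1) - A k + ε * (1 / 2) ^ k) + ε := by
        gcongr with k
        · exact hδ₀le l (hl.mono fun _ _ => inter_subset_left)
        · exact hshare k
    _ = A M + ε * ∑ k ∈ Finset.range M, (1 / 2 : ℝ) ^ k + 2 * ε := by
        rw [Finset.sum_add_distrib, Finset.sum_range_sub, Finset.mul_sum]
        ring
    _ ≤ B + ε * 2 + 2 * ε := by
        gcongr
        · exact hB M
        · exact sum_geometric_two_le M
    _ = B + 4 * ε := by ring

/-- **Monotone convergence** for chain sums. -/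
lemma tendsto_chainSum_of_monotone (hG : Monotone G) (hab : a ≤ b) {u : ℕ → K → ℝ}
    {f : K → ℝ} {A : ℕ → ℝ} {B : ℝ}
    (hu : ∀ n, Tendsto (chainSum G (u n)) (fineFilter a b) (𝓝 (A n)))
    (hmono : ∀ x, Monotone fun n => u n x)
    (hlim : ∀ x, Tendsto (fun n => u n x) atTop (𝓝 (f x))) (hB : Tendsto A atTop (𝓝 B)) :
    Tendsto (chainSum G f) (fineFilter a b) (𝓝 B) := by
  have hA : Monotone A := fun m n hmn =>
    le_of_tendsto_chainSum hG hab (hu m) (hu n) fun x => hmono x hmn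
  refine tendsto_order.2 ⟨fun c hc => ?_, fun c hc => ?_⟩
  · obtain ⟨n, hn⟩ := (hB.eventually_const_lt hc).exists
    filter_upwards [(hu n).eventually_const_lt hn,
      eventually_chainSum_le hG (fun t => (hmono t).ge_of_tendsto (hlim t) n) a b] with l h1 h2
    exact h1.trans_le h2
  · filter_upwards [eventually_chainSum_le_of_monotone hG hab hu hmono hlim
      (fun n => hA.ge_of_tendsto hB n) (ε := (c - B) / 8) (by linarith)] with l hl
    linarith

/-! ### Absolute integrability and minima -/

omit [CompactSpace K] in
/-- A fixed fine chain `l₀` and a much finer chain `l` can be recombined, interval by interval of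
`l₀`, into two fine chains such that the excess of the sum of `|φ|` over `l₀` is bounded by the
difference of the sums of `φ` over the two. -/
lemma FineChain.eventually_chainSum_abs_le (hG : Monotone G) {δ : K → Set K} (hδ : IsGauge δ)
    (φ : K → ℝ) {l₀ : List (K × K × K)} (hl₀ : FineChain δ a b l₀) :
    ∀ᶠ l in fineFilter a b, ∃ p q, FineChain δ a b p ∧ FineChain δ a b q ∧
      chainSum G (fun t => |φ t|) l₀ ≤
        chainSum G (fun t => |φ t|) l + (chainSum G φ p - chainSum G φ q) := by
  induction hl₀ with
  | nil x =>
    filter_upwards [hδ.eventually_fineChain x x] with l hl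
    exact ⟨[], [], .nil x, .nil x, by simpa using hl.chainSum_nonneg hG fun t => abs_nonneg (φ t)⟩
  | @cons x t y b l₀ hxt hty hsub hl₀ ih =>
    filter_upwards [eventually_exists_split (G := G) (hxt.trans hty) hl₀.le
      (hδ.eventually_fineChain x y) ih] with l hl
    obtain ⟨r, hr, l', ⟨p, q, hp, hq, hle⟩, hsum⟩ := hl
    replace hr : FineChain δ x y r := hr
    have hxy : 0 ≤ G y - G x := sub_nonneg.2 (hG (hxt.trans hty))
    have habs : |φ t| * (G y - G x) = |φ t * (G y - G x)| := by
      rw [abs_mul, abs_of_nonneg hxy]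
    have hr' := hr.abs_chainSum_le (f := φ) hG
    have hd : |φ t * (G y - G x)| ≤
        |chainSum G φ r| + |φ t * (G y - G x) - chainSum G φ r| := by
      have := abs_add_le (chainSum G φ r) (φ t * (G y - G x) - chainSum G φ r)
      rwa [add_sub_cancel] at this
    have hcell : FineChain δ x y [(x, t, y)] := .cons hxt hty hsub (.nil y)
    -- The recombined chains use the larger, respectively the smaller, of the two sums over `(x, y]`.
    rcases le_total (chainSum G φ r) (φ t * (G y - G x)) with h | h
    · refine ⟨_, _, hcell.append hp, hr.append hq, ?_⟩
      rw [abs_of_nonneg (sub_nonneg.2 h)] at hd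
      simp only [chainSum_append, chainSum_cons, chainSum_nil, hsum, habs]
      linarith
    · refine ⟨_, _, hr.append hp, hcell.append hq, ?_⟩
      rw [abs_of_nonpos (sub_nonpos.2 h)] at hd
      simp only [chainSum_append, chainSum_cons, chainSum_nil, hsum, habs]
      linarith

/-- If `φ` is integrable and `|φ| ≤ w` with `w` integrable, then `|φ|` is integrable. -/
lemma exists_tendsto_chainSum_abs (hG : Monotone G) (hab : a ≤ b) {φ w : K → ℝ} {A B : ℝ}
    (hφ : Tendsto (chainSum G φ) (fineFilter a b) (𝓝 A))
    (hw : Tendsto (chainSum G w) (fineFilter a b) (𝓝 B)) (hle : ∀ t, |φ t| ≤ w t) :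
    ∃ C, Tendsto (chainSum G fun t => |φ t|) (fineFilter a b) (𝓝 C) := by
  have := fineFilter_neBot hab
  set s := chainSum G fun t => |φ t| with hs_def
  have hcauchy : ∀ ε > 0, ∀ᶠ l₀ in fineFilter a b, ∀ᶠ l in fineFilter a b, s l₀ ≤ s l + ε := by
    intro ε hε
    obtain ⟨δ, hδ, hδA⟩ := mem_fineFilter.1 (hφ.eventually (Metric.ball_mem_nhds A (half_pos hε)))
    filter_upwards [hδ.eventually_fineChain a b] with l₀ hl₀
    filter_upwards [hl₀.eventually_chainSum_abs_le hG hδ φ] with l ⟨p, q, hp, hq, h⟩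
    have hp' : dist (chainSum G φ p) A < ε / 2 := hδA p hp
    have hq' : dist (chainSum G φ q) A < ε / 2 := hδA q hq
    rw [Real.dist_eq, abs_lt] at hp' hq'
    linarith
  -- The sums are almost increasing and bounded, so they converge to their limit inferior.
  set L : Set ℝ := {c | ∀ᶠ l in fineFilter a b, c ≤ s l} with hL_def
  have hLne : L.Nonempty := ⟨0, (isGauge_univ.eventually_fineChain a b).mono fun l hl =>
    hl.chainSum_nonneg hG fun t => abs_nonneg (φ t)⟩
  have hLbdd : BddAbove L := ⟨B, fun c hc => ge_of_tendsto hw <| by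
    filter_upwards [hc, eventually_chainSum_le hG hle a b] with l h1 h2 using h1.trans h2⟩
  refine ⟨sSup L, tendsto_order.2 ⟨fun c hc => ?_, fun c hc => ?_⟩⟩
  · obtain ⟨c', hc', hlt⟩ := exists_lt_of_lt_csSup hLne hc
    filter_upwards [hc'] with l hl using hlt.trans_le hl
  · filter_upwards [hcauchy ((c - sSup L) / 2) (by linarith)] with l₀ hl₀
    have : s l₀ - (c - sSup L) / 2 ∈ L := hl₀.mono fun l hl => by linarith
    linarith [le_csSup hLbdd this]

lemma exists_tendsto_chainSum_min (hG : Monotone G) (hab : a ≤ b) {φ ψ g h : K → ℝ}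
    {A A' B B' : ℝ}
    (hφ : Tendsto (chainSum G φ) (fineFilter a b) (𝓝 A))
    (hψ : Tendsto (chainSum G ψ) (fineFilter a b) (𝓝 A'))
    (hg : Tendsto (chainSum G g) (fineFilter a b) (𝓝 B))
    (hh : Tendsto (chainSum G h) (fineFilter a b) (𝓝 B'))
    (hgφ : ∀ t, g t ≤ φ t) (hφh : ∀ t, φ t ≤ h t) (hgψ : ∀ t, g t ≤ ψ t) (hψh : ∀ t, ψ t ≤ h t) :
    ∃ C, Tendsto (chainSum G fun t => min (φ t) (ψ t)) (fineFilter a b) (𝓝 C) := by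
  obtain ⟨C, hC⟩ := exists_tendsto_chainSum_abs hG hab (tendsto_chainSum_sub hφ hψ)
    (tendsto_chainSum_sub hh hg)
    fun t => abs_sub_le_iff.2 ⟨by linarith [hφh t, hgψ t], by linarith [hψh t, hgφ t]⟩
  refine ⟨_, (tendsto_chainSum_const_mul (1 / 2)
    (tendsto_chainSum_sub (tendsto_chainSum_add hφ hψ) hC)).congr fun l => ?_⟩
  congr 1
  funext t
  rcases le_total (φ t) (ψ t) with h | h
  · rw [min_eq_left h, abs_of_nonpos (sub_nonpos.2 h)]
    ring
  · rw [min_eq_right h, abs_of_nonneg (sub_nonneg.2 h)]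
    ring

/-! ### Dominated convergence -/

/-- The minimum of `F n, F (n + 1), …, F (n + p)`. -/
def runningMin (F : ℕ → K → ℝ) (n : ℕ) : ℕ → K → ℝ
  | 0, t => F n t
  | p + 1, t => min (runningMin F n p t) (F (n + (p + 1)) t)

/-- One half of dominated convergence: the sequence is bounded below by one whose integrals converge
to the integral of the limit. -/
lemma exists_lower_sequence (hG : Monotone G) (hab : a ≤ b) {F : ℕ → K → ℝ} {f g h : K → ℝ}
    {A : ℕ → ℝ} {B B' : ℝ}
    (hF : ∀ m, Tendsto (chainSum G (F m)) (fineFilter a b) (𝓝 (A m)))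
    (hg : Tendsto (chainSum G g) (fineFilter a b) (𝓝 B))
    (hh : Tendsto (chainSum G h) (fineFilter a b) (𝓝 B'))
    (hgF : ∀ m x, g x ≤ F m x) (hFh : ∀ m x, F m x ≤ h x)
    (hlim : ∀ x, Tendsto (fun m => F m x) atTop (𝓝 (f x))) :
    ∃ (c : ℕ → ℝ) (C : ℝ), (∀ n, c n ≤ A n) ∧ Tendsto c atTop (𝓝 C) ∧
      Tendsto (chainSum G f) (fineFilter a b) (𝓝 C) := by
  have hgm : ∀ n p t, g t ≤ runningMin F n p t := by
    intro n p t
    induction p with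
    | zero => exact hgF n t
    | succ p ih => exact le_min ih (hgF _ t)
  have hmF : ∀ n p j, j ≤ p → ∀ t, runningMin F n p t ≤ F (n + j) t := by
    intro n p j hj t
    induction p with
    | zero => obtain rfl : j = 0 := by omega
              exact le_rfl
    | succ p ih =>
      rcases Nat.le_succ_iff.1 hj with h | rfl
      · exact (min_le_left _ _).trans (ih h)
      · exact min_le_right _ _
  have hmh : ∀ n p t, runningMin F n p t ≤ h t := fun n p t =>
    (hmF n p 0 p.zero_le t).trans (hFh _ t)
  have hle : ∀ n p t (r : ℝ), (∀ k, n ≤ k → r ≤ F k t) → r ≤ runningMin F n p t := by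
    intro n p t r hr
    induction p with
    | zero => exact hr n le_rfl
    | succ p ih => exact le_min ih (hr _ (by omega))
  have hmint : ∀ n p, ∃ c, Tendsto (chainSum G (runningMin F n p)) (fineFilter a b) (𝓝 c) := by
    intro n p
    induction p with
    | zero => exact ⟨A n, hF n⟩
    | succ p ih =>
      obtain ⟨c, hc⟩ := ih
      exact exists_tendsto_chainSum_min hG hab hc (hF _) hg hh (hgm n p) (hmh n p) (hgF _) (hFh _)
  choose c hc using hmint
  have hanti : ∀ n t, Antitone fun p => runningMin F n p t := fun n t =>
    antitone_nat_of_succ_le fun p => min_le_left _ _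
  set i : ℕ → K → ℝ := fun n t => ⨅ p, runningMin F n p t with hi_def
  have hbdd : ∀ n t, BddBelow (range fun p => runningMin F n p t) := fun n t =>
    ⟨g t, by rintro _ ⟨p, rfl⟩; exact hgm n p t⟩
  have hi : ∀ n t, Tendsto (fun p => runningMin F n p t) atTop (𝓝 (i n t)) := fun n t =>
    tendsto_atTop_ciInf (hanti n t) (hbdd n t)
  have hiF : ∀ n k, n ≤ k → ∀ t, i n t ≤ F k t := by
    intro n k hk t
    refine (ciInf_le (hbdd n t) (k - n)).trans ((hmF n (k - n) (k - n) le_rfl t).trans ?_)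
    rw [Nat.add_sub_cancel' hk]
  have hcanti : ∀ n, Antitone (c n) := fun n p q hpq =>
    le_of_tendsto_chainSum hG hab (hc n q) (hc n p) fun t => hanti n t hpq
  have hcbdd : ∀ n, BddBelow (range (c n)) := fun n =>
    ⟨B, by rintro _ ⟨p, rfl⟩; exact le_of_tendsto_chainSum hG hab hg (hc n p) (hgm n p)⟩
  have hiint : ∀ n, Tendsto (chainSum G (i n)) (fineFilter a b) (𝓝 (⨅ p, c n p)) := by
    intro n
    have := tendsto_chainSum_of_monotone hG hab (fun p => tendsto_chainSum_neg (hc n p))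
      (fun t p q hpq => neg_le_neg (hanti n t hpq)) (fun t => (hi n t).neg)
      (tendsto_atTop_ciInf (hcanti n) (hcbdd n)).neg
    simpa using tendsto_chainSum_neg this
  have himono : ∀ t, Monotone fun n => i n t := fun t m n hmn =>
    le_ciInf fun p => hle n p t _ fun k hk => hiF m k (hmn.trans hk) t
  have hilim : ∀ t, Tendsto (fun n => i n t) atTop (𝓝 (f t)) := by
    intro t
    refine tendsto_order.2 ⟨fun r hr => ?_, fun r hr => ?_⟩
    · obtain ⟨r', hrr', hr'⟩ := exists_between hr
      obtain ⟨n₀, hn₀⟩ := eventually_atTop.1 ((hlim t).eventually_const_le hr')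
      filter_upwards [eventually_ge_atTop n₀] with n hn
      exact hrr'.trans_le (le_ciInf fun p => hle n p t r' fun k hk => hn₀ k (hn.trans hk))
    · filter_upwards [(hlim t).eventually_lt_const hr] with n hn
      exact (hiF n n le_rfl t).trans_lt hn
  have hdmono : Monotone fun n => ⨅ p, c n p := fun m n hmn =>
    le_of_tendsto_chainSum hG hab (hiint m) (hiint n) fun t => himono t hmn
  have hdlim := tendsto_atTop_ciSup hdmono ⟨B', by
    rintro _ ⟨n, rfl⟩
    exact le_of_tendsto_chainSum hG hab (hiint n) hh fun t => (hiF n n le_rfl t).trans (hFh n t)⟩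
  exact ⟨_, _, fun n => le_of_tendsto_chainSum hG hab (hiint n) (hF n) (hiF n n le_rfl), hdlim,
    tendsto_chainSum_of_monotone hG hab hiint himono hilim hdlim⟩

/-- **Dominated convergence** for chain sums. -/
lemma exists_tendsto_chainSum_of_dominated (hG : Monotone G) (hab : a ≤ b) {F : ℕ → K → ℝ}
    {f g h : K → ℝ} {A : ℕ → ℝ} {B B' : ℝ}
    (hF : ∀ m, Tendsto (chainSum G (F m)) (fineFilter a b) (𝓝 (A m)))
    (hg : Tendsto (chainSum G g) (fineFilter a b) (𝓝 B))
    (hh : Tendsto (chainSum G h) (fineFilter a b) (𝓝 B'))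
    (hgF : ∀ m x, g x ≤ F m x) (hFh : ∀ m x, F m x ≤ h x)
    (hlim : ∀ x, Tendsto (fun m => F m x) atTop (𝓝 (f x))) :
    ∃ C, Tendsto (chainSum G f) (fineFilter a b) (𝓝 C) ∧ Tendsto A atTop (𝓝 C) := by
  have := fineFilter_neBot hab
  obtain ⟨c, C, hcA, hcC, hfC⟩ := exists_lower_sequence hG hab hF hg hh hgF hFh hlim
  obtain ⟨d, D, hdA, hdD, hfD⟩ := exists_lower_sequence hG hab
    (fun m => tendsto_chainSum_neg (hF m)) (tendsto_chainSum_neg hh) (tendsto_chainSum_neg hg)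
    (fun m x => neg_le_neg (hFh m x)) (fun m x => neg_le_neg (hgF m x)) (fun x => (hlim x).neg)
  obtain rfl : D = -C := tendsto_nhds_unique hfD (tendsto_chainSum_neg hfC)
  refine ⟨C, hfC, tendsto_of_tendsto_of_tendsto_of_le_of_le hcC (by simpa using hdD.neg) hcA
    fun n => ?_⟩
  linarith [hdA n]

end Convergence

/-! ### Tagged partitions as chains -/

section Translation

variable {K : Type*} [LinearOrder K]

lemma TaggedPartition.exists_fineChain {δ : K → Set K} (P : TaggedPartition K) (hP : P.IsFine δ)
    {G f : K → ℝ} : ∃ l, FineChain δ (P.x 0) (P.x P.n) l ∧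
      riemannSum f G P = f (P.x 0) * G (P.x 0) + chainSum G f l := by
  suffices H : ∀ k ≤ P.n, ∃ l, FineChain δ (P.x 0) (P.x k) l ∧
      ∑ i ∈ Finset.range k, f (P.t i) * (G (P.x (i + 1)) - G (P.x i)) = chainSum G f l by
    obtain ⟨l, hl, hsum⟩ := H P.n le_rfl
    exact ⟨l, hl, by rw [riemannSum, hsum]⟩
  intro k hk
  induction k with
  | zero => exact ⟨[], .nil _, by simp⟩
  | succ k ih =>
    obtain ⟨l, hl, hsum⟩ := ih (by omega)
    have ht := P.tag_mem k hk
    refine ⟨_, hl.append (.cons ht.1 ht.2 (hP k hk) (.nil _)), ?_⟩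
    rw [Finset.sum_range_succ, hsum]
    simp

lemma FineChain.exists_sequences {δ : K → Set K} {a b : K} {l : List (K × K × K)}
    (hl : FineChain δ a b l) (G f : K → ℝ) :
    ∃ (n : ℕ) (x t : ℕ → K), x 0 = a ∧ x n = b ∧
      (∀ i < n, t i ∈ Icc (x i) (x (i + 1)) ∧ Ioc (x i) (x (i + 1)) ⊆ δ (t i)) ∧
      ∑ i ∈ Finset.range n, f (t i) * (G (x (i + 1)) - G (x i)) = chainSum G f l := by
  induction hl with
  | nil a => exact ⟨0, fun _ => a, fun _ => a, rfl, rfl, by simp, by simp⟩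
  | @cons a s y b l has hsy hsub _ ih =>
    obtain ⟨n, x, t, rfl, hxn, hx, hsum⟩ := ih
    refine ⟨n + 1, fun i => Nat.casesOn i a x, fun i => Nat.casesOn i s t, rfl, hxn, ?_, ?_⟩
    · rintro (_ | i) hi
      · exact ⟨⟨has, hsy⟩, hsub⟩
      · exact hx i (by omega)
    · rw [Finset.sum_range_succ', chainSum_cons, ← hsum, add_comm]
      rfl

lemma FineChain.exists_taggedPartition {δ : K → Set K} {a b : K} (ha : IsBot a) (hb : IsTop b)
    {l : List (K × K × K)} (hl : FineChain δ a b l) (G f : K → ℝ) :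
    ∃ P : TaggedPartition K, P.IsFine δ ∧ riemannSum f G P = f a * G a + chainSum G f l := by
  obtain ⟨n, x, t, rfl, rfl, hx, hsum⟩ := hl.exists_sequences G f
  exact ⟨⟨n, x, t, ha, hb, fun i hi => (hx i hi).1.1.trans (hx i hi).1.2, fun i hi => (hx i hi).1⟩,
    fun i hi => (hx i hi).2, by rw [riemannSum, hsum]⟩

lemma hasIntegral_iff_tendsto [TopologicalSpace K] {a b : K} (ha : IsBot a) (hb : IsTop b)
    {f G : K → ℝ} {A : ℝ} : HasIntegral f G A ↔
      Tendsto (chainSum G f) (fineFilter a b) (𝓝 (A - f a * G a)) := by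
  have key : ∀ s : ℝ, s - (A - f a * G a) = f a * G a + s - A := fun s => by ring
  refine ⟨fun h => Metric.tendsto_nhds.2 fun ε hε => ?_, fun h ε hε => ?_⟩
  · obtain ⟨δ, hδ, hP⟩ := h ε hε
    refine ⟨δ, hδ, fun l hl => ?_⟩
    obtain ⟨P, hPδ, hsum⟩ := hl.exists_taggedPartition ha hb G f
    have := hP P hPδ
    rw [hsum] at this
    change dist _ _ < ε
    rwa [Real.dist_eq, key]
  · obtain ⟨δ, hδ, hl⟩ := mem_fineFilter.1 (Metric.tendsto_nhds.1 h ε hε)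
    refine ⟨δ, hδ, fun P hP => ?_⟩
    obtain ⟨l, hl', hsum⟩ := P.exists_fineChain hP (G := G) (f := f)
    have hx0 : P.x 0 = a := le_antisymm (P.isBot_first a) (ha _)
    have hxn : P.x P.n = b := le_antisymm (hb _) (P.isTop_last b)
    rw [hx0, hxn] at hl'
    rw [hx0] at hsum
    have : dist _ _ < ε := hl l hl'
    rwa [Real.dist_eq, key, ← hsum] at this

lemma Integrable.hasIntegral_integral [TopologicalSpace K] {f G : K → ℝ} (hf : Integrable f G) :
    HasIntegral f G (integral f G) := by
  rw [integral, dif_pos hf]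
  exact hf.choose_spec

end Translation

end CompactLine

theorem mainTheorem5 {K : Type*} [LinearOrder K] [TopologicalSpace K] [OrderTopology K]
    [CompactSpace K] [Nonempty K]
    (G : K → ℝ) (hGmono : Monotone G) (hGpos : ∀ x, 0 ≤ G x)
    (hGam : CompactLine.IsAmenable G)
    (F : ℕ → K → ℝ) (g h f : K → ℝ)
    (hF : ∀ m, CompactLine.Integrable (F m) G)
    (hg : CompactLine.Integrable g G) (hh : CompactLine.Integrable h G)
    (hgF : ∀ m x, g x ≤ F m x) (hFh : ∀ m x, F m x ≤ h x)
    (hlim : ∀ x, Tendsto (fun m => F m x) atTop (𝓝 (f x))) :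
    CompactLine.Integrable f G ∧
      Tendsto (fun m => CompactLine.integral (F m) G) atTop
        (𝓝 (CompactLine.integral f G)) := by
  obtain ⟨a, -, ha⟩ := (isCompact_univ (X := K)).exists_isLeast univ_nonempty
  obtain ⟨b, -, hb⟩ := (isCompact_univ (X := K)).exists_isGreatest univ_nonempty
  replace ha : IsBot a := fun x => ha (mem_univ x)
  replace hb : IsTop b := fun x => hb (mem_univ x)
  have hab : a ≤ b := ha b
  have := CompactLine.fineFilter_neBot hab
  have htend : ∀ {φ : K → ℝ}, CompactLine.Integrable φ G →
      Tendsto (CompactLine.chainSum G φ) (CompactLine.fineFilter a b)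
        (𝓝 (CompactLine.integral φ G - φ a * G a)) := fun hφ =>
    (CompactLine.hasIntegral_iff_tendsto ha hb).1 hφ.hasIntegral_integral
  obtain ⟨C, hfC, hC⟩ := CompactLine.exists_tendsto_chainSum_of_dominated hGmono hab
    (fun m => htend (hF m)) (htend hg) (htend hh) hgF hFh hlim
  have hf : CompactLine.Integrable f G :=
    ⟨C + f a * G a, (CompactLine.hasIntegral_iff_tendsto ha hb).2 (by simpa using hfC)⟩
  refine ⟨hf, ?_⟩
  obtain rfl : C = _ := tendsto_nhds_unique hfC (htend hf)
  simpa using hC.add ((hlim a).mul_const (G a))
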